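/- Let $L$ be a first-order language and $T$ a complete $L$-theory. For $m\in\mathbb N$ and a cardinal $\kappa$, an *ird-pattern of width $\kappa$ witnessed by $m$-formulas* consists of $L$-formulas $\varphi_i(x;y_i)$ $(i\in\kappa)$, where $x$ is a tuple of $m$ variables and each $y_i$ is a finite tuple of variables, together with tuples $b_{i,j}$ $(i\in\kappa,\ j\in\omega)$ with $|b_{i,j}|=|y_i|$ from a model of $T$, such that for every $\eta\in\omega^\kappa$ the set of formulas $$\{\varphi_i(x;b_{i,j}) : i\in\kappa,\ j\in\omega,\ j\ge\eta(i)\}\cup\{\neg\varphi_i(x;b_{i,j}) : i\in\kappa,\ j\in\omega,\ j<\eta(i)\}$$ is consistent (i.e. finitely satisfiable in that model). Let $\kappa^m_{\mathrm{ird}}(T)$ be the least cardinal $\kappa$ such that there is no ird-pattern of width $\kappa$ witnessed by $m$-formulas, with $\kappa^m_{\mathrm{ird}}(T)=\infty$ if there is no such $\kappa$, where $\infty$ is larger than every cardinal and $\infty+\lambda=\lambda+\infty=\infty$ for every $\lambda$ (a cardinal or $\infty$). Let $\kappa_{\mathrm{ird}}(T)=\sup_{m\in\omega}\kappa^m_{\mathrm{ird}}(T)$.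 Then: 1. $\kappa^{m+n}_{\mathrm{ird}}(T)+1\le\kappa^m_{\mathrm{ird}}(T)+\kappa^n_{\mathrm{ird}}(T)$ for all $m,n\in\mathbb N$. 2. For every $m\in\mathbb N$, if $\kappa^m_{\mathrm{ird}}(T)$ is infinite (i.e. $\kappa^m_{\mathrm{ird}}(T)\ge\aleph_0$, the value $\infty$ included), then $\kappa^m_{\mathrm{ird}}(T)=\kappa^1_{\mathrm{ird}}(T)=\kappa_{\mathrm{ird}}(T)$. -/

import Mathlib

open FirstOrder Cardinal

universe u v w

namespace IrdPattern

/-- `φ(x; b)`: the formula with parameters in `M` obtained from `φ(x; y)`, `|x| = m`, `|y| = k`,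
by substituting the tuple `b` for `y`. -/
def subst {L : FirstOrder.Language.{u, v}} {M : Type w} {m k : ℕ}
    (φ : L.Formula (Fin m ⊕ Fin k)) (b : Fin k → M) : L[[M]].Formula (Fin m) :=
  Language.BoundedFormula.constantsVarsEquiv.symm
    (Language.Formula.relabel
      (Sum.elim (fun i => Sum.inr i) (fun j => Sum.inl (b j)) : Fin m ⊕ Fin k → M ⊕ Fin m) φ)

open Classical in
/-- `φ^{if c}`: the formula `φ` if the condition `c` is true, and `¬ φ` if it is false. -/
noncomputable def ifCond {L : FirstOrder.Language.{u, v}} {α : Type*} (φ : L.Formula α) (c : Prop) :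
    L.Formula α :=
  if c then φ else Language.Formula.not φ

/-- Consistency of a set `p` of formulas with parameters in the structure `M`, i.e. consistency
with the elementary diagram of `M`: every finite part of `p` is realized in `M`. -/
def IsConsistent {L : FirstOrder.Language.{u, v}} (M : Type w) [L.Structure M] {m : ℕ}
    (p : Set (L[[M]].Formula (Fin m))) : Prop :=
  ∀ s : Set (L[[M]].Formula (Fin m)), s ⊆ p → s.Finite →
    ∃ a : Fin m → M, ∀ ψ ∈ s, Language.Formula.Realize ψ a

/-- The formulas `φ i (x; y i)` and the tuples `b i j` of `M` (`i : ι`, `j : ℕ`) form an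
ird-pattern: for every `η : ι → ℕ`, the set of all `φ i (x; b i j)^{if j ≥ η i}` is consistent. -/
def IsIrdPattern {L : FirstOrder.Language.{u, v}} (M : Type w) [L.Structure M] {ι : Type*} {m : ℕ}
    {k : ι → ℕ} (φ : ∀ i, L.Formula (Fin m ⊕ Fin (k i))) (b : ∀ i, ℕ → Fin (k i) → M) : Prop :=
  ∀ η : ι → ℕ,
    IsConsistent M {ψ | ∃ (i : ι) (j : ℕ), ψ = ifCond (subst (φ i) (b i j)) (j ≥ η i)}

/-- There is, in `T`, an ird-pattern of width `κ` witnessed by `m`-formulas. The parameters are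
taken in a model of `T`; for complete `T` every such pattern of small width occurs in any
sufficiently saturated (monster) model, and conversely. -/
def HasIrdPattern {L : FirstOrder.Language.{u, v}} (T : L.Theory) (m : ℕ) (κ : Cardinal.{max u v}) : Prop :=
  ∃ (ι : Type (max u v)) (M : Language.Theory.ModelType.{u, v, max u v} T) (k : ι → ℕ)
    (φ : ∀ i, L.Formula (Fin m ⊕ Fin (k i))) (b : ∀ i, ℕ → Fin (k i) → M),
    #ι = κ ∧ IsIrdPattern M φ b

open Classical in
/-- `κ^m_ird(T)`: the least cardinal `κ` such that there is no ird-pattern of width `κ` witnessed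
by `m`-formulas, and `∞` (`⊤`) if there is no such `κ`. (If such a `κ` exists at all, the least
one is at most the successor of `|L| + ℵ₀`, so the universe of cardinals is immaterial.) -/
noncomputable def kappaIrdVar {L : FirstOrder.Language.{u, v}} (T : L.Theory) (m : ℕ) :
    WithTop Cardinal.{max u v} :=
  if ∃ κ : Cardinal.{max u v}, ¬ HasIrdPattern T m κ then
    ((sInf {κ : Cardinal.{max u v} | ¬ HasIrdPattern T m κ} : Cardinal.{max u v}) :
      WithTop Cardinal.{max u v})
  else ⊤

/-- `κ_ird(T)`: the supremum of `κ^m_ird(T)` over all `m`, in the cardinals with `∞` on top. -/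
noncomputable def kappaIrd {L : FirstOrder.Language.{u, v}} (T : L.Theory) : WithTop Cardinal.{max u v} :=
  ⨆ m : ℕ, kappaIrdVar T m

end IrdPattern

/-! The core is `IsIrdPattern.exists_split`: the rows of a pattern in `m + n` variables split into
the rows of a pattern in `m` variables and the rows of one in `n` variables. An ultrapower turns the
pattern into mutually indiscernible rows of order type `ℤ + ℤᵒᵈ` and a tuple `(a, c)` such that in
every row `φ i` holds of `(a, c)` exactly on the upper half. A second ultrapower makes the half-rows
mutually indiscernible over `a` alone.

Say that `a` cuts a row if some formula over `a` and further parameters from the rows changes its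
truth value when points next to the middle of that row cross it. For a cut row this formula is the
new formula in `m` variables: mutual indiscernibility carries the cut of `a` to any prescribed `η`
(`exists_isIrdPattern_of_cuts`). The uncut rows stay mutually indiscernible over `a`, since points
can cross the middle one after another. So `c` gives a pattern in `n` variables with `a` among the
parameters (`exists_isIrdPattern_of_not_cuts`).

Hence a pattern of width `κ` in `m + n` variables has `κ = κ₁ + κ₂` with patterns of widths `κ₁` and
`κ₂` in `m` and `n` variables. The rest is cardinal arithmetic: the bound with `+ 1`, then induction
on the number of variables. -/

namespace IrdPattern

open Filter

/-! ### Generic order-indiscernible sequences from iterated ultrafilters -/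

section IndiscernibleUltrafilter

variable {X : Type*}

/-- Iterated quantifier `∀ᶠ a₁, ∀ᶠ a₂, …, ∀ᶠ aₙ` along the hyperfilter on `ℕ`. -/
def IterEventually : ℕ → (List ℕ → Prop) → Prop
  | 0, Q => Q []
  | n + 1, Q => ∀ᶠ a in (hyperfilter ℕ : Filter ℕ), IterEventually n fun t => Q (a :: t)

theorem IterEventually.mono {n : ℕ} {Q Q' : List ℕ → Prop} (h : ∀ t, Q t → Q' t)
    (hQ : IterEventually n Q) : IterEventually n Q' := by
  induction n generalizing Q Q' with
  | zero => exact h _ hQ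
  | succ n ih => exact Eventually.mono hQ fun a ha => ih (fun t => h _) ha

theorem iterEventually_gt (n a : ℕ) : IterEventually n fun t => ∀ x ∈ t, a < x := by
  induction n with
  | zero => intro x hx; simp at hx
  | succ n ih =>
    have h : ∀ᶠ b in (hyperfilter ℕ : Filter ℕ), a < b :=
      (Nat.hyperfilter_le_atTop) (eventually_gt_atTop a)
    refine h.mono fun b hb => ih.mono fun t ht => ?_
    simpa [hb] using ht

theorem IterEventually.and {n : ℕ} {Q Q' : List ℕ → Prop} (h : IterEventually n Q)
    (h' : IterEventually n Q') : IterEventually n fun t => Q t ∧ Q' t := by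
  induction n generalizing Q Q' with
  | zero => exact ⟨h, h'⟩
  | succ n ih => exact (Eventually.and h h').mono fun a ha => ih ha.1 ha.2

theorem iterEventually_pairwise (n : ℕ) : IterEventually n fun t => t.Pairwise (· < ·) := by
  induction n with
  | zero => exact List.Pairwise.nil
  | succ n ih =>
    refine Eventually.of_forall fun a => ((iterEventually_gt n a).and ih).mono fun t ht => ?_
    exact List.pairwise_cons.2 ht

open Classical in
/-- The iterated ultrafilter on functions `X → ℕ`, whose values are chosen along the list. -/
noncomputable def iterUltrafilter : List X → Ultrafilter (X → ℕ)
  | [] => pure fun _ => 0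
  | x :: l => (hyperfilter ℕ).bind fun n => (iterUltrafilter l).map fun g => Function.update g x n

/-- Entries of `l` outside `l'` contribute quantifiers over a dummy variable, which disappear. Only
the number of relevant entries remains. -/
theorem eventually_iterUltrafilter_of_sublist {l' l : List X} (h : l'.Sublist l) (hl : l.Nodup)
    (Q : List ℕ → Prop) :
    (∀ᶠ g in (iterUltrafilter l : Filter (X → ℕ)), Q (l'.map g)) ↔
      IterEventually l'.length Q := by
  classical
  induction h generalizing Q with
  | slnil => exact Iff.rfl
  | @cons l₁ l₂ x h ih =>
    have hx : x ∉ l₁ := fun hx => (List.nodup_cons.1 hl).1 (h.subset hx)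
    have key : ∀ (g : X → ℕ) (n : ℕ), l₁.map (Function.update g x n) = l₁.map g := by
      intro g n
      refine List.map_congr_left fun y hy => Function.update_of_ne ?_ _ _
      rintro rfl; exact hx hy
    change (∀ᶠ n in (hyperfilter ℕ : Filter ℕ), ∀ᶠ g in (iterUltrafilter l₂ : Filter (X → ℕ)),
      Q (l₁.map (Function.update g x n))) ↔ _
    simp only [key, ih (List.nodup_cons.1 hl).2 Q, eventually_const]
  | @cons_cons l₁ l₂ x h ih =>
    have hx : x ∉ l₁ := fun hx => (List.nodup_cons.1 hl).1 (h.subset hx)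
    have key : ∀ (g : X → ℕ) (n : ℕ),
        (x :: l₁).map (Function.update g x n) = n :: l₁.map g := by
      intro g n
      rw [List.map_cons, Function.update_self]
      congr 1
      refine List.map_congr_left fun y hy => Function.update_of_ne ?_ _ _
      rintro rfl; exact hx hy
    change (∀ᶠ n in (hyperfilter ℕ : Filter ℕ), ∀ᶠ g in (iterUltrafilter l₂ : Filter (X → ℕ)),
      Q ((x :: l₁).map (Function.update g x n))) ↔ _
    simp only [key]
    exact eventually_congr (Eventually.of_forall fun n =>
      ih (List.nodup_cons.1 hl).2 fun t => Q (n :: t))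

/-- An ultrafilter on pairs `(F, g)`, with `g : X → ℕ` strictly increasing on the finite set `F`,
which contains every finite set eventually, and for which `g` is generic and order-indiscernible. -/
structure IsIndiscernible [LinearOrder X] (W : Ultrafilter (Finset X × (X → ℕ))) : Prop where
  subset (F : Finset X) : ∀ᶠ p in (W : Filter (Finset X × (X → ℕ))), F ⊆ p.1
  strictMonoOn : ∀ᶠ p in (W : Filter (Finset X × (X → ℕ))), StrictMonoOn p.2 p.1
  map_iff (l : List X) (hl : l.SortedLT) (Q : List ℕ → Prop) :
    (∀ᶠ p in (W : Filter (Finset X × (X → ℕ))), Q (l.map p.2)) ↔ IterEventually l.length Q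

/-- No Ramsey argument is needed: `F` is chosen along an ultrafilter finer than `atTop`, then `g`
along the hyperfilter iterated over the sorted `F`. A fixed sorted list is eventually a sublist of
the sorted `F`. -/
theorem exists_isIndiscernible (X : Type*) [LinearOrder X] :
    ∃ W : Ultrafilter (Finset X × (X → ℕ)), IsIndiscernible W := by
  classical
  let V : Ultrafilter (Finset X) := Ultrafilter.of atTop
  let W : Ultrafilter (Finset X × (X → ℕ)) :=
    V.bind fun F => (iterUltrafilter F.sort).map fun g => (F, g)
  have hW : ∀ P : Finset X × (X → ℕ) → Prop, (∀ᶠ p in (W : Filter (Finset X × (X → ℕ))), P p) ↔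
      ∀ᶠ F in (V : Filter (Finset X)), ∀ᶠ g in (iterUltrafilter F.sort : Filter (X → ℕ)),
        P (F, g) := fun P => Iff.rfl
  have hV : ∀ F : Finset X, ∀ᶠ F' in (V : Filter (Finset X)), F ⊆ F' := fun F =>
    (Ultrafilter.of_le atTop) (eventually_ge_atTop F)
  refine ⟨W, fun F => ?_, ?_, fun l hl Q => ?_⟩
  · rw [hW]
    exact (hV F).mono fun F' hF' => Eventually.of_forall fun _ => hF'
  · rw [hW]
    refine Eventually.of_forall fun F => ?_
    refine ((eventually_iterUltrafilter_of_sublist (List.Sublist.refl F.sort) (F.sort_nodup _)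
      (fun t => t.Pairwise (· < ·))).2 (iterEventually_pairwise _)).mono fun g hg => ?_
    intro x hx y hy hxy
    rw [List.pairwise_map] at hg
    have hs := F.sortedLT_sort.pairwise
    obtain ⟨i, hi, rfl⟩ := List.mem_iff_getElem.1 ((Finset.mem_sort (· ≤ ·)).2 hx)
    obtain ⟨j, hj, rfl⟩ := List.mem_iff_getElem.1 ((Finset.mem_sort (· ≤ ·)).2 hy)
    have hij : i < j := by
      by_contra hij
      rcases (not_lt.1 hij).lt_or_eq with h | h
      · exact absurd (List.pairwise_iff_getElem.1 hs j i hj hi h) (not_lt.2 hxy.le)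
      · subst h; exact lt_irrefl _ hxy
    exact List.pairwise_iff_getElem.1 hg i j hi hj hij
  · rw [hW]
    have : ∀ᶠ F in (V : Filter (Finset X)),
        ((∀ᶠ g in (iterUltrafilter F.sort : Filter (X → ℕ)), Q (l.map g)) ↔
          IterEventually l.length Q) := by
      refine (hV l.toFinset).mono fun F hF => ?_
      refine eventually_iterUltrafilter_of_sublist ?_ (F.sort_nodup _) Q
      refine List.sublist_of_subperm_of_sortedLE ?_ hl.sortedLE F.sortedLT_sort.sortedLE
      refine hl.nodup.subperm fun x hx => ?_
      exact (Finset.mem_sort (· ≤ ·)).2 (hF (List.mem_toFinset.2 hx))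
    rw [eventually_congr this, eventually_const]

/-- Both sides reduce to the same iterated quantifier, because the images of `f` and `f'`, once
sorted, have equal length. Repeated values are allowed. -/
theorem IsIndiscernible.comp_iff [LinearOrder X] {W : Ultrafilter (Finset X × (X → ℕ))}
    (hW : IsIndiscernible W) {Z : Type*} [Finite Z] {f f' : Z → X}
    (h : ∀ z z', f z < f z' ↔ f' z < f' z') (P : (Z → ℕ) → Prop) :
    (∀ᶠ p in (W : Filter (Finset X × (X → ℕ))), P fun z => p.2 (f z)) ↔
      ∀ᶠ p in (W : Filter (Finset X × (X → ℕ))), P fun z => p.2 (f' z) := by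
  classical
  have := Fintype.ofFinite Z
  have heq : ∀ z z', f z = f z' → f' z = f' z' := fun z z' hz =>
    le_antisymm (not_lt.1 fun h1 => ((h z' z).2 h1).ne hz.symm)
      (not_lt.1 fun h1 => ((h z z').2 h1).ne hz)
  let e : X → X := Function.extend f f' id
  have he : ∀ z, e (f z) = f' z := fun z =>
    Function.FactorsThrough.extend_apply (f := f) (g := f') (fun a b hab => heq a b hab) id z
  let l : List X := (Finset.univ.image f).sort
  have hl : l.SortedLT := Finset.sortedLT_sort _
  have hmem : ∀ z, f z ∈ l := fun z =>
    (Finset.mem_sort (· ≤ ·)).2 (Finset.mem_image_of_mem f (Finset.mem_univ z))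
  have hmem' : ∀ x ∈ l, ∃ z, f z = x := fun x hx => by
    have := (Finset.mem_sort (· ≤ ·)).1 hx
    simpa using this
  have hl' : (l.map e).SortedLT := by
    have : (l.map e).Pairwise (· < ·) := by
      rw [List.pairwise_map]
      refine hl.pairwise.imp_of_mem fun {x y} hx hy hxy => ?_
      obtain ⟨z, rfl⟩ := hmem' x hx
      obtain ⟨z', rfl⟩ := hmem' y hy
      rw [he, he]
      exact (h z z').1 hxy
    exact this.sortedLT
  -- The tuple is read back from the sorted list of its values; the default `0` is never reached on
  -- `l.map g`.
  let Q : List ℕ → Prop := fun t => P fun z => t.getD (l.idxOf (f z)) 0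
  have hQ : ∀ g : X → ℕ, Q (l.map g) ↔ P fun z => g (f z) := by
    intro g
    have : (fun z => (l.map g).getD (l.idxOf (f z)) 0) = fun z => g (f z) := by
      funext z
      have hlt : l.idxOf (f z) < l.length := List.idxOf_lt_length_of_mem (hmem z)
      rw [List.getD_eq_getElem _ _ (by simpa using hlt)]
      simp
    change P _ ↔ _
    rw [this]
  have h1 := hW.map_iff l hl Q
  have h2 := hW.map_iff (l.map e) hl' Q
  rw [List.length_map] at h2
  simp only [List.map_map, hQ, Function.comp_apply, he] at h1 h2
  rw [h1, h2]

end IndiscernibleUltrafilter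

/-! ### Two-sided rows and the ultrapowers that make them indiscernible -/

section

theorem realize_subst {L : FirstOrder.Language.{u, v}} {M : Type w} [L.Structure M] {m k : ℕ}
    (φ : L.Formula (Fin m ⊕ Fin k)) (b : Fin k → M) (a : Fin m → M) :
    (subst φ b).Realize a ↔ φ.Realize (Sum.elim a b) := by
  unfold subst Language.Formula.Realize
  rw [← Language.BoundedFormula.realize_constantsVarsEquiv, Equiv.apply_symm_apply]
  change Language.Formula.Realize _ _ ↔ Language.Formula.Realize _ _
  rw [Language.Formula.realize_relabel]
  apply iff_of_eq
  congr 1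
  funext x
  rcases x with x | x <;> rfl

theorem realize_ifCond {L : FirstOrder.Language.{u, v}} {α M : Type*} [L.Structure M]
    (φ : L.Formula α) (c : Prop) (a : α → M) : (ifCond φ c).Realize a ↔ (φ.Realize a ↔ c) := by
  by_cases hc : c <;> simp [ifCond, hc, Language.Formula.realize_not]

theorem isIrdPattern_iff {L : FirstOrder.Language.{u, v}} {M : Type w} [L.Structure M]
    {ι : Type*} {m : ℕ} {k : ι → ℕ} {φ : ∀ i, L.Formula (Fin m ⊕ Fin (k i))}
    {b : ∀ i, ℕ → Fin (k i) → M} :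
    IsIrdPattern M φ b ↔ ∀ (η : ι → ℕ) (G : Finset (ι × ℕ)), ∃ a : Fin m → M, ∀ p ∈ G,
      ((φ p.1).Realize (Sum.elim a (b p.1 p.2)) ↔ η p.1 ≤ p.2) := by
  classical
  let Ψ : (ι → ℕ) → ι × ℕ → L[[M]].Formula (Fin m) := fun η p =>
    ifCond (subst (φ p.1) (b p.1 p.2)) (p.2 ≥ η p.1)
  have hΨ : ∀ η p a, (Ψ η p).Realize a ↔
      ((φ p.1).Realize (Sum.elim a (b p.1 p.2)) ↔ η p.1 ≤ p.2) := fun η p a => by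
    rw [realize_ifCond, realize_subst]
  constructor
  · intro h η G
    obtain ⟨a, ha⟩ := h η (Ψ η '' G) (by rintro _ ⟨p, -, rfl⟩; exact ⟨p.1, p.2, rfl⟩)
      (G.finite_toSet.image _)
    exact ⟨a, fun p hp => (hΨ η p a).1 (ha _ ⟨p, hp, rfl⟩)⟩
  · intro h η s hs hfin
    have hs' : s ⊆ Ψ η '' Set.univ := fun ψ hψ => by
      obtain ⟨i, j, rfl⟩ := hs hψ
      exact ⟨(i, j), trivial, rfl⟩
    obtain ⟨G, -, hG, rfl⟩ := Set.exists_subset_image_finite_and.1 ⟨s, hs', hfin, rfl⟩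
    obtain ⟨a, ha⟩ := h η hG.toFinset
    refine ⟨a, ?_⟩
    rintro _ ⟨p, hp, rfl⟩
    exact (hΨ η p a).2 (ha p (hG.mem_toFinset.2 hp))

/-- A two-sided row of order type `ℤ + ℤᵒᵈ`: the points `(false, z)` increase with `z`, the points
`(true, z)` lie above them and decrease with `z`, so both halves approach the cut in the middle. -/
def rowPos : Bool × ℤ → ℤ ⊕ₗ ℤᵒᵈ
  | (false, z) => toLex (Sum.inl z)
  | (true, z) => toLex (Sum.inr (OrderDual.toDual z))

theorem rowPos_lt {x y : Bool × ℤ} : rowPos x < rowPos y ↔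
    (x.1 = false ∧ y.1 = true) ∨ (x.1 = false ∧ y.1 = false ∧ x.2 < y.2) ∨
      (x.1 = true ∧ y.1 = true ∧ y.2 < x.2) := by
  obtain ⟨s, z⟩ := x
  obtain ⟨s', z'⟩ := y
  cases s <;> cases s' <;> simp [rowPos]

variable (L : FirstOrder.Language.{u, v}) {N : Type*} [L.Structure N] {ι : Type*}

/-- The two-sided rows `b i` of tuples (with coordinates in `ℕ`) are mutually indiscernible. -/
def MutuallyIndiscernible (b : ι → ℕ → Bool × ℤ → N) : Prop :=
  ∀ (k : ℕ) (row : Fin k → ι) (coord : Fin k → ℕ) (f f' : Fin k → Bool × ℤ),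
    (∀ z z', row z = row z' → (rowPos (f z) < rowPos (f z') ↔ rowPos (f' z) < rowPos (f' z'))) →
    ∀ θ : L.Formula (Fin k), θ.Realize (fun z => b (row z) (coord z) (f z)) ↔
      θ.Realize fun z => b (row z) (coord z) (f' z)

/-- The half-rows `b i _ (s, ·)` are mutually indiscernible over the tuple `a`. -/
def HalvesIndiscernibleOver {m : ℕ} (a : Fin m → N) (b : ι → ℕ → Bool × ℤ → N) : Prop :=
  ∀ (k : ℕ) (row : Fin k → ι) (coord : Fin k → ℕ) (f f' : Fin k → Bool × ℤ),
    (∀ z, (f z).1 = (f' z).1) →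
    (∀ z z', row z = row z' → (f z).1 = (f z').1 → ((f z).2 < (f z').2 ↔ (f' z).2 < (f' z').2)) →
    ∀ θ : L.Formula (Fin m ⊕ Fin k),
      θ.Realize (Sum.elim a fun z => b (row z) (coord z) (f z)) ↔
        θ.Realize (Sum.elim a fun z => b (row z) (coord z) (f' z))

variable {L}

theorem MutuallyIndiscernible.realize_iff {b : ι → ℕ → Bool × ℤ → N}
    (hb : MutuallyIndiscernible L b) {Z : Type*} [Finite Z] (row : Z → ι) (coord : Z → ℕ)
    {f f' : Z → Bool × ℤ}
    (h : ∀ z z', row z = row z' →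
      (rowPos (f z) < rowPos (f z') ↔ rowPos (f' z) < rowPos (f' z')))
    (θ : L.Formula Z) : θ.Realize (fun z => b (row z) (coord z) (f z)) ↔
      θ.Realize fun z => b (row z) (coord z) (f' z) := by
  obtain ⟨k, ⟨e⟩⟩ := Finite.exists_equiv_fin Z
  have := hb k (row ∘ e.symm) (coord ∘ e.symm) (f ∘ e.symm) (f' ∘ e.symm)
    (fun z z' hz => h _ _ hz) (θ.relabel e)
  simpa [Language.Formula.realize_relabel, Function.comp_def] using this

theorem HalvesIndiscernibleOver.realize_iff {m : ℕ} {a : Fin m → N} {b : ι → ℕ → Bool × ℤ → N}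
    (hb : HalvesIndiscernibleOver L a b) {Z : Type*} [Finite Z] (row : Z → ι) (coord : Z → ℕ)
    {f f' : Z → Bool × ℤ} (h₁ : ∀ z, (f z).1 = (f' z).1)
    (h₂ : ∀ z z', row z = row z' → (f z).1 = (f z').1 →
      ((f z).2 < (f z').2 ↔ (f' z).2 < (f' z').2))
    (θ : L.Formula (Fin m ⊕ Z)) :
    θ.Realize (Sum.elim a fun z => b (row z) (coord z) (f z)) ↔
      θ.Realize (Sum.elim a fun z => b (row z) (coord z) (f' z)) := by
  obtain ⟨k, ⟨e⟩⟩ := Finite.exists_equiv_fin Z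
  have := hb k (row ∘ e.symm) (coord ∘ e.symm) (f ∘ e.symm) (f' ∘ e.symm)
    (fun z => h₁ _) (fun z z' hz => h₂ _ _ hz) (θ.relabel (Sum.map id e))
  simpa [Language.Formula.realize_relabel, Function.comp_def, Sum.elim_map] using this

/-- Łoś's theorem, packaged so that the ultrapower is used only through `mk`. -/
theorem exists_ultrapower {α M : Type w} [L.Structure M] [Nonempty M] (W : Ultrafilter α) :
    ∃ (N : Type w) (_ : L.Structure N) (_ : Nonempty N) (_ : M ≅[L] N) (mk : (α → M) → N),
      ∀ (β : Type) (θ : L.Formula β) (x : β → α → M),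
        θ.Realize (fun i => mk (x i)) ↔ ∀ᶠ p in (W : Filter α), θ.Realize fun i => x i p := by
  refine ⟨(W : Filter α).Product fun _ => M, inferInstance, inferInstance, ?_,
    fun x => (x : (W : Filter α).Product fun _ => M),
    fun β θ x => Language.Ultraproduct.realize_formula_cast θ x⟩
  refine Language.elementarilyEquivalent_iff.2 fun φ => ?_
  rw [Language.Ultraproduct.sentence_realize, eventually_const]

-- On a finite set of positions, any strictly increasing `g` leaves room for a threshold between the
-- two halves of each row: one more than the largest value on the lower half.
open Classical in
theorem exists_cut [LinearOrder ι] (F : Finset (ι ×ₗ (ℤ ⊕ₗ ℤᵒᵈ)))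
    (g : ι ×ₗ (ℤ ⊕ₗ ℤᵒᵈ) → ℕ) (hg : StrictMonoOn g F) :
    ∃ η : ι → ℕ, ∀ i s z, toLex (i, rowPos (s, z)) ∈ F →
      (η i ≤ g (toLex (i, rowPos (s, z))) ↔ s = true) := by
  refine ⟨fun i => (F.filter fun x => ∃ z, x = toLex (i, rowPos (false, z))).sup
    fun x => g x + 1, fun i s z hx => ?_⟩
  cases s with
  | false =>
    simp only [Bool.false_eq_true, iff_false, not_le]
    exact Finset.le_sup (f := fun x => g x + 1) (Finset.mem_filter.2 ⟨hx, z, rfl⟩)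
  | true =>
    simp only [iff_true]
    refine Finset.sup_le fun x hx' => ?_
    obtain ⟨hxF, z', rfl⟩ := Finset.mem_filter.1 hx'
    refine hg hxF hx ?_
    rw [Prod.Lex.toLex_lt_toLex]
    exact Or.inr ⟨rfl, (rowPos_lt (x := (false, z')) (y := (true, z))).2 (Or.inl ⟨rfl, rfl⟩)⟩

/-- A tuple realizing a cut through all rows of a mutually indiscernible array. -/
theorem IsIrdPattern.exists_mutuallyIndiscernible {ι M : Type w} [L.Structure M] [Nonempty M]
    {m : ℕ} {k : ι → ℕ} {φ : ∀ i, L.Formula (Fin m ⊕ Fin (k i))} {b : ∀ i, ℕ → Fin (k i) → M}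
    (h : IsIrdPattern M φ b) :
    ∃ (N : Type w) (_ : L.Structure N) (_ : Nonempty N) (_ : M ≅[L] N) (a : Fin m → N)
      (b' : ι → ℕ → Bool × ℤ → N), MutuallyIndiscernible L b' ∧
        ∀ i s z, (φ i).Realize (Sum.elim a fun q => b' i q (s, z)) ↔ s = true := by
  classical
  let _ : LinearOrder ι := linearOrderOfSTO WellOrderingRel
  rw [isIrdPattern_iff] at h
  obtain ⟨W, hW⟩ := exists_isIndiscernible (ι ×ₗ (ℤ ⊕ₗ ℤᵒᵈ))
  obtain ⟨N, _, _, hN, mk, hmk⟩ := exists_ultrapower (L := L) (M := M) W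
  let B : ι → ℕ → ℕ → M := fun i j q =>
    if hq : q < k i then b i j ⟨q, hq⟩ else Classical.arbitrary M
  have hB : ∀ i j (q : Fin (k i)), B i j q = b i j q := fun i j q => by simp [B]
  -- Consistency realizes only finitely many conditions, which is why the finite set `F` accompanies
  -- `g`. Where `g` is not increasing on `F` the tuple is irrelevant.
  have hA : ∀ p : Finset (ι ×ₗ (ℤ ⊕ₗ ℤᵒᵈ)) × (ι ×ₗ (ℤ ⊕ₗ ℤᵒᵈ) → ℕ), ∃ a : Fin m → M,
      StrictMonoOn p.2 p.1 → ∀ i s z, toLex (i, rowPos (s, z)) ∈ p.1 →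
        ((φ i).Realize (Sum.elim a fun q => B i (p.2 (toLex (i, rowPos (s, z)))) q) ↔
          s = true) := by
    intro p
    by_cases hp : StrictMonoOn p.2 p.1
    · obtain ⟨η, hη⟩ := exists_cut p.1 p.2 hp
      obtain ⟨a, ha⟩ := h η (p.1.image fun x => ((ofLex x).1, p.2 x))
      refine ⟨a, fun _ i s z hx => ?_⟩
      rw [← hη i s z hx]
      simp only [hB]
      exact ha (i, p.2 (toLex (i, rowPos (s, z)))) (Finset.mem_image_of_mem _ hx)
    · exact ⟨fun _ => Classical.arbitrary M, fun hp' => absurd hp' hp⟩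
  choose A hA using hA
  let bE : ι → ℕ → Bool × ℤ → (Finset (ι ×ₗ (ℤ ⊕ₗ ℤᵒᵈ)) × (ι ×ₗ (ℤ ⊕ₗ ℤᵒᵈ) → ℕ)) → M :=
    fun i q x p => B i (p.2 (toLex (i, rowPos x))) q
  refine ⟨N, inferInstance, inferInstance, hN, fun q => mk fun p => A p q,
    fun i q x => mk (bE i q x), ?_, ?_⟩
  · intro l row coord f f' hf θ
    refine (hmk _ θ fun z => bE (row z) (coord z) (f z)).trans (Iff.trans ?_
      (hmk _ θ fun z => bE (row z) (coord z) (f' z)).symm)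
    refine hW.comp_iff (f := fun z => toLex (row z, rowPos (f z)))
      (f' := fun z => toLex (row z, rowPos (f' z))) (fun z z' => ?_)
      (fun t => θ.Realize fun z => B (row z) (t z) (coord z))
    -- In the lexicographic order the rows are consecutive blocks, so order agreement within each
    -- row suffices.
    rw [Prod.Lex.toLex_lt_toLex, Prod.Lex.toLex_lt_toLex]
    refine or_congr_right (and_congr_right fun hr => hf z z' hr)
  · intro i s z
    have h1 := hmk _ (φ i) (Sum.elim (fun q p => A p q) fun q : Fin (k i) => bE i q (s, z))
    have h2 : (fun x => mk (Sum.elim (fun q p => A p q) (fun q : Fin (k i) => bE i q (s, z)) x)) =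
        Sum.elim (fun q => mk fun p => A p q) fun q : Fin (k i) => mk (bE i q (s, z)) := by
      funext x; rcases x with x | x <;> rfl
    rw [h2] at h1
    rw [h1]
    have h3 : ∀ᶠ p in (W : Filter _), (((φ i).Realize fun x =>
        Sum.elim (fun q p => A p q) (fun q : Fin (k i) => bE i q (s, z)) x p) ↔ s = true) := by
      filter_upwards [hW.strictMonoOn, hW.subset {toLex (i, rowPos (s, z))}] with p hp hp'
      rw [← hA p hp i s z (hp' (Finset.mem_singleton_self _))]
      apply iff_of_eq
      congr 1
      funext x; rcases x with x | x <;> rfl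
    rw [eventually_congr h3, eventually_const]

/-- Passing to halves of the rows that are mutually indiscernible over the realization. -/
theorem MutuallyIndiscernible.exists_halvesIndiscernibleOver {ι M : Type w} [L.Structure M]
    [Nonempty M] {m n : ℕ} {k : ι → ℕ} {φ : ∀ i, L.Formula (Fin (m + n) ⊕ Fin (k i))}
    {a : Fin m → M} {c : Fin n → M} {b : ι → ℕ → Bool × ℤ → M} (hb : MutuallyIndiscernible L b)
    (hφ : ∀ i s z, (φ i).Realize (Sum.elim (Fin.append a c) fun q => b i q (s, z)) ↔ s = true) :
    ∃ (N : Type w) (_ : L.Structure N) (_ : Nonempty N) (_ : M ≅[L] N) (a' : Fin m → N)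
      (c' : Fin n → N) (b' : ι → ℕ → Bool × ℤ → N), MutuallyIndiscernible L b' ∧
        HalvesIndiscernibleOver L a' b' ∧
        ∀ i s z, (φ i).Realize (Sum.elim (Fin.append a' c') fun q => b' i q (s, z)) ↔
          s = true := by
  classical
  let _ : LinearOrder ι := linearOrderOfSTO WellOrderingRel
  obtain ⟨W, hW⟩ := exists_isIndiscernible ((ι ×ₗ Bool) ×ₗ ℤ)
  let Ω := Finset ((ι ×ₗ Bool) ×ₗ ℤ) × ((ι ×ₗ Bool) ×ₗ ℤ → ℕ)
  obtain ⟨N, _, _, hN, mk, hmk⟩ := exists_ultrapower (L := L) (M := M) W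
  -- Each half-row is a block of its own; its points are resampled within the same half, while `a`
  -- and `c` stay constant.
  let pos : ι → Bool × ℤ → (ι ×ₗ Bool) ×ₗ ℤ := fun i x => toLex (toLex (i, x.1), x.2)
  let bE : ι → ℕ → Bool × ℤ → Ω → M := fun i q x p => b i q (x.1, (p.2 (pos i x) : ℤ))
  refine ⟨N, inferInstance, inferInstance, hN, fun q => mk fun _ => a q,
    fun q => mk fun _ => c q, fun i q x => mk (bE i q x), ?_, ?_, ?_⟩
  · intro l row coord f f' hf θ
    refine (hmk _ θ fun z => bE (row z) (coord z) (f z)).trans (Iff.trans ?_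
      (hmk _ θ fun z => bE (row z) (coord z) (f' z)).symm)
    -- Resampling is increasing on each half, so it preserves the order of every row and the old
    -- mutual indiscernibility survives.
    have key : ∀ (e : Fin l → Bool × ℤ) (p : Ω), StrictMonoOn p.2 p.1 →
        (Finset.univ.image fun z => pos (row z) (e z)) ⊆ p.1 → ∀ z z', row z = row z' →
        (rowPos ((e z).1, (p.2 (pos (row z) (e z)) : ℤ)) <
            rowPos ((e z').1, (p.2 (pos (row z') (e z')) : ℤ)) ↔
          rowPos (e z) < rowPos (e z')) := by
      intro e p hp hs z z' hr
      have hm : ∀ z, pos (row z) (e z) ∈ p.1 := fun z =>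
        hs (Finset.mem_image_of_mem _ (Finset.mem_univ z))
      have hlt : ∀ z z', row z = row z' → (e z).1 = (e z').1 →
          (p.2 (pos (row z) (e z)) < p.2 (pos (row z') (e z')) ↔ (e z).2 < (e z').2) := by
        intro z z' hr hs
        rw [hp.lt_iff_lt (hm z) (hm z')]
        simp [pos, Prod.Lex.toLex_lt_toLex, hr, hs]
      simp only [rowPos_lt, Nat.cast_lt]
      have h1 := hlt z z' hr
      have h2 := hlt z' z hr.symm
      cases h3 : (e z).1 <;> cases h4 : (e z').1 <;> simp_all
    refine eventually_congr ?_
    filter_upwards [hW.strictMonoOn, hW.subset (Finset.univ.image fun z => pos (row z) (f z)),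
      hW.subset (Finset.univ.image fun z => pos (row z) (f' z))] with p hp h1 h2
    refine hb l row coord (fun z => ((f z).1, (p.2 (pos (row z) (f z)) : ℤ)))
      (fun z => ((f' z).1, (p.2 (pos (row z) (f' z)) : ℤ))) (fun z z' hr => ?_) θ
    rw [key f p hp h1 z z' hr, key f' p hp h2 z z' hr, hf z z' hr]
  · intro l row coord f f' hf hf' θ
    have h2 : ∀ f : Fin l → Bool × ℤ, (fun x => mk (Sum.elim (fun q _ => a q)
        (fun z => bE (row z) (coord z) (f z)) x)) =
        Sum.elim (fun q => mk fun _ => a q) fun z => mk (bE (row z) (coord z) (f z)) := by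
      intro f; funext x; rcases x with x | x <;> rfl
    rw [← h2, ← h2, hmk, hmk]
    have h3 : ∀ (e : Fin l → Bool × ℤ) (_ : ∀ z, (f z).1 = (e z).1) (p : Ω),
        (fun x => Sum.elim (fun q _ => a q) (fun z => bE (row z) (coord z) (e z)) x p) =
          Sum.elim a fun z => b (row z) (coord z) ((f z).1, (p.2 (pos (row z) (e z)) : ℤ)) := by
      intro e he p
      funext x; rcases x with x | x
      · rfl
      · simp [bE, he]
    have h4 : ∀ (e : Fin l → Bool × ℤ) (_ : ∀ z, (f z).1 = (e z).1),
        (∀ᶠ p in (W : Filter Ω), θ.Realize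
          fun x => Sum.elim (fun q _ => a q) (fun z => bE (row z) (coord z) (e z)) x p) ↔
        ∀ᶠ p in (W : Filter Ω), θ.Realize (Sum.elim a fun z =>
          b (row z) (coord z) ((f z).1, (p.2 (pos (row z) (e z)) : ℤ))) := fun e he =>
      eventually_congr (Eventually.of_forall fun p => by rw [h3 e he p])
    refine (h4 f fun _ => rfl).trans (Iff.trans ?_ (h4 f' hf).symm)
    refine hW.comp_iff (f := fun z => pos (row z) (f z)) (f' := fun z => pos (row z) (f' z))
      (fun z z' => ?_) (fun t => θ.Realize (Sum.elim a fun z =>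
        b (row z) (coord z) ((f z).1, (t z : ℤ))))
    simp only [pos, Prod.Lex.toLex_lt_toLex, hf]
    refine or_congr_right (and_congr_right fun hr => ?_)
    simp only [EmbeddingLike.apply_eq_iff_eq, Prod.mk.injEq] at hr
    exact hf' z z' hr.1 (by rw [hf, hf, hr.2])
  · intro i s z
    have h1 := hmk _ (φ i)
      (Sum.elim (fun q _ => Fin.append a c q) fun q : Fin (k i) => bE i q (s, z))
    have h2 : (fun x => mk (Sum.elim (fun q _ => Fin.append a c q)
          (fun q : Fin (k i) => bE i q (s, z)) x)) =
        Sum.elim (Fin.append (fun q => mk fun _ => a q) fun q => mk fun _ => c q)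
          fun q : Fin (k i) => mk (bE i q (s, z)) := by
      funext x; rcases x with x | x
      · refine Fin.addCases (fun x => ?_) (fun x => ?_) x <;> simp
      · rfl
    rw [h2] at h1
    rw [h1]
    have h3 : ∀ p : Ω, (((φ i).Realize fun x =>
        Sum.elim (fun q _ => Fin.append a c q) (fun q : Fin (k i) => bE i q (s, z)) x p) ↔
          s = true) := by
      intro p
      rw [← hφ i s (p.2 (pos i (s, z)))]
      apply iff_of_eq
      congr 1
      funext x; rcases x with x | x <;> rfl
    exact (eventually_congr (Eventually.of_forall h3)).trans eventually_const

end

/-! ### Cut rows, uncut rows, and the splitting of a pattern -/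

section

variable {L : FirstOrder.Language.{u, v}} {N : Type*} [L.Structure N] {ι : Type*}

/-- `f'` arises from `f` by moving points of the `i`-th row through the cut in the middle, all the
other points lying outside of the region of the move. -/
def MovesThroughCut {Z : Type*} (i : ι) (row : Z → ι) (f f' : Z → Bool × ℤ) : Prop :=
  ∀ z, ((f z).2 < 0 ∧ f' z = f z) ∨ (row z = i ∧ f z = (true, 0) ∧ f' z = (false, 0))

variable (L) in
/-- The tuple `a` cuts the `i`-th row in the middle, as seen by a formula with parameters in `b`. -/
def Cuts {m : ℕ} (a : Fin m → N) (b : ι → ℕ → Bool × ℤ → N) (i : ι) : Prop :=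
  ∃ (k : ℕ) (ψ : L.Formula (Fin m ⊕ Fin k)) (row : Fin k → ι) (coord : Fin k → ℕ)
    (f f' : Fin k → Bool × ℤ), MovesThroughCut i row f f' ∧
      ψ.Realize (Sum.elim a fun z => b (row z) (coord z) (f z)) ∧
      ¬ ψ.Realize (Sum.elim a fun z => b (row z) (coord z) (f' z))

theorem realize_iff_of_not_cuts {m : ℕ} {a : Fin m → N} {b : ι → ℕ → Bool × ℤ → N} {i : ι}
    (h : ¬ Cuts L a b i) {Z : Type*} [Finite Z] (row : Z → ι) (coord : Z → ℕ)
    {f f' : Z → Bool × ℤ} (hf : MovesThroughCut i row f f') (θ : L.Formula (Fin m ⊕ Z)) :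
    θ.Realize (Sum.elim a fun z => b (row z) (coord z) (f z)) ↔
      θ.Realize (Sum.elim a fun z => b (row z) (coord z) (f' z)) := by
  obtain ⟨k, ⟨e⟩⟩ := Finite.exists_equiv_fin Z
  have key : ∀ θ : L.Formula (Fin m ⊕ Z),
      θ.Realize (Sum.elim a fun z => b (row z) (coord z) (f z)) →
      θ.Realize (Sum.elim a fun z => b (row z) (coord z) (f' z)) := by
    intro θ hθ
    by_contra hθ'
    refine h ⟨k, θ.relabel (Sum.map id e), row ∘ e.symm, coord ∘ e.symm, f ∘ e.symm,
      f' ∘ e.symm, fun z => hf _, ?_, ?_⟩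
    · simpa [Language.Formula.realize_relabel, Function.comp_def, Sum.elim_map] using hθ
    · simpa [Language.Formula.realize_relabel, Function.comp_def, Sum.elim_map] using hθ'
  refine ⟨key θ, fun hθ => ?_⟩
  by_contra hθ'
  exact (Language.Formula.realize_not.1 (key θ.not (Language.Formula.realize_not.2 hθ'))) hθ

/-- Equality of types transfers the formula `∃ x, ⋀ χ`; this replaces moving `a` by an automorphism
of a monster model. -/
theorem exists_realize_of_forall_realize_iff {m : ℕ} {Z G : Type*} [Finite G] {v v' : Z → N}
    (h : ∀ θ : L.Formula Z, θ.Realize v ↔ θ.Realize v') (χ : G → L.Formula (Z ⊕ Fin m))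
    {a : Fin m → N} (ha : ∀ g, (χ g).Realize (Sum.elim v' a)) :
    ∃ a' : Fin m → N, ∀ g, (χ g).Realize (Sum.elim v a') := by
  have := (h (Language.Formula.iExs (Fin m) (Language.Formula.iInf χ))).2
    (Language.Formula.realize_iExs.2 ⟨a, Language.BoundedFormula.realize_iInf.2 ha⟩)
  obtain ⟨a', ha'⟩ := Language.Formula.realize_iExs.1 this
  exact ⟨a', Language.BoundedFormula.realize_iInf.1 ha'⟩

/-- The rows cut by `a` carry an ird-pattern in the variables of `a`. -/
theorem exists_isIrdPattern_of_cuts {m : ℕ} {a : Fin m → N} {b : ι → ℕ → Bool × ℤ → N}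
    (hb : MutuallyIndiscernible L b) (hab : HalvesIndiscernibleOver L a b) (I : Set ι)
    (hI : ∀ i ∈ I, Cuts L a b i) :
    ∃ (k : I → ℕ) (φ : ∀ i, L.Formula (Fin m ⊕ Fin (k i))) (b' : ∀ i, ℕ → Fin (k i) → N),
      IsIrdPattern N φ b' := by
  classical
  choose k ψ row coord f f' hf hψ hψ' using fun i : I => hI i i.2
  -- Outer parameters, with negative coordinates, stay fixed; the crossing points are placed at `j`
  -- in the lower half.
  refine ⟨k, ψ, fun i j z => b (row i z) (coord i z) (if (f i z).2 < 0 then f i z else (false, j)),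
    ?_⟩
  rw [isIrdPattern_iff]
  intro η G
  obtain ⟨B, hB⟩ : ∃ B : ℕ, ∀ p ∈ G, p.2 ≤ B := ⟨G.sup Prod.snd, fun p hp => Finset.le_sup hp⟩
  let Z := Σ p : G, Fin (k p.1.1)
  let rowZ : Z → ι := fun z => row z.1.1.1 z.2
  let coordZ : Z → ℕ := fun z => coord z.1.1.1 z.2
  let F : Z → Bool × ℤ := fun z =>
    if (f z.1.1.1 z.2).2 < 0 then f z.1.1.1 z.2 else (false, z.1.1.2)
  -- Points from `η` on cross the middle. Since the upper half runs backwards, `B - j` restores the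
  -- order; being nonnegative, it stays closer to the middle than all outer points.
  let F' : Z → Bool × ℤ := fun z =>
    if (f z.1.1.1 z.2).2 < 0 then f z.1.1.1 z.2 else
      if η z.1.1.1 ≤ z.1.1.2 then (true, B - z.1.1.2) else (false, z.1.1.2)
  have hF : ∀ z z' : Z, rowZ z = rowZ z' →
      (rowPos (F z) < rowPos (F z') ↔ rowPos (F' z) < rowPos (F' z')) := by
    rintro ⟨⟨⟨i, j⟩, hp⟩, z⟩ ⟨⟨⟨i', j'⟩, hp'⟩, z'⟩ hr
    have hj := hB _ hp
    have hj' := hB _ hp'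
    simp only [rowZ] at hr
    simp only at hj hj'
    simp only [F, F', rowPos_lt]
    rcases hf i z with ⟨h1, -⟩ | ⟨h1, h2, -⟩ <;> rcases hf i' z' with ⟨h1', -⟩ | ⟨h1', h2', -⟩
    · simp [h1, h1']
    · simp only [h1, h2', if_true, lt_irrefl, if_false]
      cases hs : (f i z).1 <;> split_ifs <;> simp <;> omega
    · simp only [h1', h2, if_true, lt_irrefl, if_false]
      cases hs : (f i' z').1 <;> split_ifs <;> simp <;> omega
    · have : i = i' := Subtype.ext (h1.symm.trans (hr.trans h1'))
      subst this
      simp only [h2, h2', lt_irrefl, if_false]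
      split_ifs <;> simp <;> omega
  have hχ : ∀ (p : G) (v : Z → N) (a : Fin m → N),
      (ifCond ((ψ p.1.1).relabel (Sum.elim Sum.inr fun z => Sum.inl (⟨p, z⟩ : Z)) :
        L.Formula (Z ⊕ Fin m)) (η p.1.1 ≤ p.1.2)).Realize (Sum.elim v a) ↔
      ((ψ p.1.1).Realize (Sum.elim a fun z => v ⟨p, z⟩) ↔ η p.1.1 ≤ p.1.2) := by
    intro p v a
    rw [realize_ifCond, Language.Formula.realize_relabel]
    refine iff_congr (iff_of_eq ?_) Iff.rfl
    congr 1
    funext x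
    rcases x with x | x <;> rfl
  obtain ⟨a', ha'⟩ := exists_realize_of_forall_realize_iff (hb.realize_iff rowZ coordZ hF)
    (fun p : G => ifCond ((ψ p.1.1).relabel (Sum.elim Sum.inr fun z => Sum.inl (⟨p, z⟩ : Z)) :
        L.Formula (Z ⊕ Fin m)) (η p.1.1 ≤ p.1.2)) (a := a) (fun p => by
      rw [hχ]
      obtain ⟨⟨i, j⟩, hp⟩ := p
      have hj := hB _ hp
      simp only at hj
      simp only [F', rowZ, coordZ]
      -- The parameters of the pair `(i, j)` now match `f i` or `f' i` on each half-row, so `a`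
      -- itself decides `ψ i` as required.
      by_cases hη : η i ≤ j
      · simp only [hη, if_true, iff_true]
        refine (hab.realize_iff (row i) (coord i) (f := f i) ?_ ?_ _).1 (hψ i)
        · intro z
          rcases hf i z with ⟨h1, -⟩ | ⟨-, h1, -⟩ <;> simp [h1]
        · intro z z' _ _
          rcases hf i z with ⟨h1, -⟩ | ⟨-, h1, -⟩ <;>
            rcases hf i z' with ⟨h1', -⟩ | ⟨-, h1', -⟩ <;> simp [h1, h1'] <;> omega
      · simp only [hη, if_false, iff_false]
        refine fun h => hψ' i ((hab.realize_iff (row i) (coord i) (f := f' i) ?_ ?_ _).2 h)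
        · intro z
          rcases hf i z with ⟨h1, h2⟩ | ⟨-, h1, h2⟩ <;> simp [h1, h2]
        · intro z z' _ _
          rcases hf i z with ⟨h1, h2⟩ | ⟨-, h1, h2⟩ <;>
            rcases hf i z' with ⟨h1', h2'⟩ | ⟨-, h1', h2'⟩ <;> simp [h1, h1', h2, h2'] <;> omega)
  exact ⟨a', fun p hp => (hχ ⟨p, hp⟩ _ a').1 (ha' ⟨p, hp⟩)⟩

/-- If `a` does not cut the rows in question, all points can be moved to the lower half-rows. -/
theorem exists_lower_of_not_cuts {m : ℕ} {a : Fin m → N} {b : ι → ℕ → Bool × ℤ → N}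
    (hab : HalvesIndiscernibleOver L a b) {Z : Type*} [Finite Z] (row : Z → ι) (coord : Z → ℕ)
    (hrow : ∀ z, ¬ Cuts L a b (row z)) (f : Z → Bool × ℤ) :
    ∃ f₀ : Z → Bool × ℤ, (∀ z, (f₀ z).1 = false) ∧
      (∀ z z', row z = row z' →
        (rowPos (f z) < rowPos (f z') ↔ rowPos (f₀ z) < rowPos (f₀ z'))) ∧
      ∀ θ : L.Formula (Fin m ⊕ Z),
        θ.Realize (Sum.elim a fun z => b (row z) (coord z) (f z)) ↔
          θ.Realize (Sum.elim a fun z => b (row z) (coord z) (f₀ z)) := by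
  classical
  have := Fintype.ofFinite Z
  induction hn : (Finset.univ.filter fun z => (f z).1 = true).card using Nat.strong_induction_on
    generalizing f with
  | _ n ih =>
  by_cases hne : (Finset.univ.filter fun z => (f z).1 = true).Nonempty
  swap
  · refine ⟨f, fun z => ?_, fun _ _ _ => Iff.rfl, fun _ => Iff.rfl⟩
    by_contra hz
    exact hne ⟨z, by simpa using hz⟩
  -- The maximal coordinate in the upper half marks the point nearest the middle, hence the first
  -- that can cross without changing the order.
  obtain ⟨z₀, hz₀, hmax⟩ := Finset.exists_max_image _ (fun z => (f z).2) hne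
  obtain ⟨B, hB⟩ : ∃ B : ℤ, ∀ z, (f z).2 ≤ B :=
    ⟨(f (Finset.univ.exists_max_image (fun z => (f z).2) ⟨z₀, Finset.mem_univ _⟩).choose).2,
      fun z => (Finset.univ.exists_max_image (fun z => (f z).2)
        ⟨z₀, Finset.mem_univ _⟩).choose_spec.2 z (Finset.mem_univ z)⟩
  simp only [Finset.mem_filter, Finset.mem_univ, true_and] at hz₀ hmax
  set t := (f z₀).2 with ht
  set i := row z₀ with hi
  -- All indices naming this point move together, to `B + 1`, above every lower point in use. The
  -- shifts in `g`, one for each half-row, put the moving point at `0` and everything else below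
  -- `0`, the shape required by `MovesThroughCut`.
  let S : Z → Prop := fun z => row z = i ∧ (f z).1 = true ∧ (f z).2 = t
  let f₁ : Z → Bool × ℤ := fun z => if S z then (false, B + 1) else f z
  let g : Z → Bool × ℤ := fun z =>
    ((f z).1, if row z = i ∧ (f z).1 = true then (f z).2 - t else (f z).2 - B - 1)
  let g' : Z → Bool × ℤ := fun z => if S z then (false, 0) else g z
  have hgg' : MovesThroughCut i row g g' := by
    intro z
    have h1 := hB z
    have h2 := hmax z
    by_cases hz : S z
    · right
      obtain ⟨hz1, hz2, hz3⟩ := hz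
      simp [g, g', S, hz1, hz2, hz3]
    · left
      refine ⟨?_, by simp [g', hz]⟩
      simp only [g]
      split_ifs with h
      · have : (f z).2 ≠ t := fun h' => hz ⟨h.1, h.2, h'⟩
        have := h2 h.2
        omega
      · omega
  have e1 : ∀ θ : L.Formula (Fin m ⊕ Z),
      θ.Realize (Sum.elim a fun z => b (row z) (coord z) (f z)) ↔
        θ.Realize (Sum.elim a fun z => b (row z) (coord z) (f₁ z)) := by
    intro θ
    refine (hab.realize_iff row coord (f := f) (f' := g) (fun z => rfl) ?_ θ).trans
      ((realize_iff_of_not_cuts (hrow z₀) row coord hgg' θ).trans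
        (hab.realize_iff row coord ?_ ?_ θ))
    · intro z z' hr hs
      simp only [g, hr, hs]
      split_ifs <;> omega
    · intro z
      by_cases hz : S z <;> simp [g', f₁, hz, g]
    · intro z z' hr hs
      have h1 := hB z
      have h2 := hB z'
      have h3 := hmax z
      have h4 := hmax z'
      by_cases hz : S z <;> by_cases hz' : S z'
      · simp [g', f₁, hz, hz']
      · simp only [g', f₁, hz, hz', if_true, if_false, g] at hs ⊢
        simp only [← hs, Bool.false_eq_true, and_false, if_false]
        omega
      · simp only [g', f₁, hz, hz', if_true, if_false, g] at hs ⊢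
        simp only [hs, Bool.false_eq_true, and_false, if_false]
        omega
      · simp only [g', f₁, hz, hz', if_false, g] at hs ⊢
        simp only [hr, hs]
        split_ifs <;> omega
  have e2 : ∀ z z', row z = row z' →
      (rowPos (f z) < rowPos (f z') ↔ rowPos (f₁ z) < rowPos (f₁ z')) := by
    intro z z' hr
    have h1 := hB z
    have h2 := hB z'
    have h3 := hmax z
    have h4 := hmax z'
    by_cases hz : S z <;> by_cases hz' : S z'
    · simp only [f₁, hz, hz', if_true, rowPos_lt]
      obtain ⟨-, hz2, hz3⟩ := hz
      obtain ⟨-, hz2', hz3'⟩ := hz'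
      simp [hz2, hz3, hz2', hz3']
    · simp only [f₁, hz, hz', if_true, if_false, rowPos_lt]
      obtain ⟨hz1, hz2, hz3⟩ := hz
      have hne : (f z').1 = true → (f z').2 ≠ t := fun h h' => hz' ⟨hr.symm.trans hz1, h, h'⟩
      cases hs : (f z').1 <;> simp only [hs, forall_true_left] at hne h3 h4 <;>
        simp [hz2, hz3] <;> omega
    · simp only [f₁, hz, hz', if_true, if_false, rowPos_lt]
      obtain ⟨hz1, hz2, hz3⟩ := hz'
      have hne : (f z).1 = true → (f z).2 ≠ t := fun h h' => hz ⟨hr.trans hz1, h, h'⟩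
      cases hs : (f z).1 <;> simp only [hs, forall_true_left] at hne h3 h4 <;>
        simp [hz2, hz3] <;> omega
    · simp [f₁, hz, hz']
  have hlt : (Finset.univ.filter fun z => (f₁ z).1 = true).card < n := by
    rw [← hn]
    refine Finset.card_lt_card ⟨fun z hz => ?_, fun h => ?_⟩
    · simp only [Finset.mem_filter, Finset.mem_univ, true_and] at hz ⊢
      by_cases hS : S z
      · exact hS.2.1
      · simpa [f₁, hS] using hz
    · have h0 := h (Finset.mem_filter.2 ⟨Finset.mem_univ z₀, hz₀⟩)
      have hS : S z₀ := ⟨rfl, hz₀, rfl⟩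
      simp [f₁, hS] at h0
  obtain ⟨f₀, hf₀, h1, h2⟩ := ih _ hlt f₁ rfl
  exact ⟨f₀, hf₀, fun z z' hr => (e2 z z' hr).trans (h1 z z' hr), fun θ => (e1 θ).trans (h2 θ)⟩

/-- With all points brought into the lower halves, indiscernibility of the half-rows over `a` gives
mutual indiscernibility of the full rows over `a`. -/
theorem realize_iff_of_forall_not_cuts {m : ℕ} {a : Fin m → N} {b : ι → ℕ → Bool × ℤ → N}
    (hab : HalvesIndiscernibleOver L a b) {Z : Type*} [Finite Z] (row : Z → ι) (coord : Z → ℕ)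
    (hrow : ∀ z, ¬ Cuts L a b (row z)) {f f' : Z → Bool × ℤ}
    (h : ∀ z z', row z = row z' →
      (rowPos (f z) < rowPos (f z') ↔ rowPos (f' z) < rowPos (f' z')))
    (θ : L.Formula (Fin m ⊕ Z)) :
    θ.Realize (Sum.elim a fun z => b (row z) (coord z) (f z)) ↔
      θ.Realize (Sum.elim a fun z => b (row z) (coord z) (f' z)) := by
  obtain ⟨f₀, h0, h1, h2⟩ := exists_lower_of_not_cuts hab row coord hrow f
  obtain ⟨f₀', h0', h1', h2'⟩ := exists_lower_of_not_cuts hab row coord hrow f'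
  rw [h2, h2']
  refine hab.realize_iff row coord (fun z => by rw [h0, h0']) (fun z z' hr _ => ?_) θ
  have := ((h1 z z' hr).symm.trans (h z z' hr)).trans (h1' z z' hr)
  simpa [rowPos_lt, h0, h0'] using this

/-- The rows not cut by `a` carry an ird-pattern in the remaining variables. -/
theorem exists_isIrdPattern_of_not_cuts {m n : ℕ} {k : ι → ℕ}
    {φ : ∀ i, L.Formula (Fin (m + n) ⊕ Fin (k i))} {a : Fin m → N} {c : Fin n → N}
    {b : ι → ℕ → Bool × ℤ → N} (hab : HalvesIndiscernibleOver L a b)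
    (hφ : ∀ i s z, (φ i).Realize (Sum.elim (Fin.append a c) fun q => b i q (s, z)) ↔ s = true)
    (I : Set ι) (hI : ∀ i ∈ I, ¬ Cuts L a b i) :
    ∃ (k' : I → ℕ) (φ' : ∀ i, L.Formula (Fin n ⊕ Fin (k' i))) (b' : ∀ i, ℕ → Fin (k' i) → N),
      IsIrdPattern N φ' b' := by
  classical
  -- The variables of `a` become parameter variables, filled by `a` in every column.
  refine ⟨fun i => m + k i, fun i => (φ i).relabel (Sum.elim
    (Fin.addCases (fun q => Sum.inr (Fin.castAdd _ q)) Sum.inl) fun q => Sum.inr (Fin.natAdd m q)),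
    fun i j => Fin.append a fun q => b i q (false, j), ?_⟩
  rw [isIrdPattern_iff]
  intro η G
  have key : ∀ (i : ι) (c' : Fin n → N) (y : Fin (k i) → N), ((φ i).relabel (Sum.elim
      (Fin.addCases (fun q => Sum.inr (Fin.castAdd _ q)) Sum.inl)
        fun q => Sum.inr (Fin.natAdd m q)) : L.Formula (Fin n ⊕ Fin (m + k i))).Realize
        (Sum.elim c' (Fin.append a y)) ↔ (φ i).Realize (Sum.elim (Fin.append a c') y) := by
    intro i c' y
    rw [Language.Formula.realize_relabel]
    apply iff_of_eq
    congr 1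
    funext x
    rcases x with x | x
    · refine Fin.addCases (fun x => ?_) (fun x => ?_) x <;> simp
    · simp
  simp only [key]
  obtain ⟨B, hB⟩ : ∃ B : ℕ, ∀ p ∈ G, p.2 ≤ B := ⟨G.sup Prod.snd, fun p hp => Finset.le_sup hp⟩
  let Z := Σ p : G, Fin (k p.1.1)
  let rowZ : Z → ι := fun z => z.1.1.1
  let coordZ : Z → ℕ := fun z => z.2
  let F : Z → Bool × ℤ := fun z => (false, z.1.1.2)
  let F' : Z → Bool × ℤ := fun z =>
    if η z.1.1.1 ≤ z.1.1.2 then (true, B - z.1.1.2) else (false, z.1.1.2)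
  have hF : ∀ z z' : Z, rowZ z = rowZ z' →
      (rowPos (F z) < rowPos (F z') ↔ rowPos (F' z) < rowPos (F' z')) := by
    rintro ⟨⟨⟨i, j⟩, hp⟩, z⟩ ⟨⟨⟨i', j'⟩, hp'⟩, z'⟩ hr
    have : i = i' := Subtype.ext hr
    subst this
    simp only [F, F', rowPos_lt]
    split_ifs <;> simp <;> omega
  have hχ : ∀ (p : G) (v : Z → N) (c' : Fin n → N),
      (ifCond ((φ p.1.1).relabel (Sum.elim (Fin.addCases (fun q => Sum.inl (Sum.inl q)) Sum.inr)
        fun z => Sum.inl (Sum.inr (⟨p, z⟩ : Z))) :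
        L.Formula ((Fin m ⊕ Z) ⊕ Fin n)) (η p.1.1 ≤ p.1.2)).Realize
          (Sum.elim (Sum.elim a v) c') ↔
      ((φ p.1.1).Realize (Sum.elim (Fin.append a c') fun z => v ⟨p, z⟩) ↔
        η p.1.1 ≤ p.1.2) := by
    intro p v c'
    rw [realize_ifCond, Language.Formula.realize_relabel]
    refine iff_congr (iff_of_eq ?_) Iff.rfl
    congr 1
    funext x
    rcases x with x | x
    · refine Fin.addCases (fun x => ?_) (fun x => ?_) x <;> simp
    · simp
  obtain ⟨c', hc'⟩ := exists_realize_of_forall_realize_iff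
    (realize_iff_of_forall_not_cuts hab rowZ coordZ (fun z => hI _ z.1.1.1.2) hF)
    (fun p : G => ifCond ((φ p.1.1).relabel
        (Sum.elim (Fin.addCases (fun q => Sum.inl (Sum.inl q)) Sum.inr)
        fun z => Sum.inl (Sum.inr (⟨p, z⟩ : Z))) :
        L.Formula ((Fin m ⊕ Z) ⊕ Fin n)) (η p.1.1 ≤ p.1.2)) (a := c) (fun p => by
      rw [hχ]
      simp only [F', rowZ, coordZ]
      split_ifs with h
      · simp [hφ, h]
      · simp [hφ, h])
  exact ⟨c', fun p hp => (hχ ⟨p, hp⟩ _ c').1 (hc' ⟨p, hp⟩)⟩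

/-- The rows of an ird-pattern in `m + n` variables can be divided into those of an ird-pattern in
`m` variables and those of an ird-pattern in `n` variables. -/
theorem IsIrdPattern.exists_split {ι M : Type w} [L.Structure M] [Nonempty M] {m n : ℕ}
    {k : ι → ℕ} {φ : ∀ i, L.Formula (Fin (m + n) ⊕ Fin (k i))} {b : ∀ i, ℕ → Fin (k i) → M}
    (h : IsIrdPattern M φ b) :
    ∃ (N : Type w) (_ : L.Structure N) (_ : Nonempty N) (_ : M ≅[L] N) (I : Set ι),
      (∃ (k : I → ℕ) (φ : ∀ i, L.Formula (Fin m ⊕ Fin (k i))) (b : ∀ i, ℕ → Fin (k i) → N),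
        IsIrdPattern N φ b) ∧
      ∃ (k : (Iᶜ : Set ι) → ℕ) (φ : ∀ i, L.Formula (Fin n ⊕ Fin (k i)))
        (b : ∀ i, ℕ → Fin (k i) → N), IsIrdPattern N φ b := by
  obtain ⟨N₁, _, _, e₁, x, b₁, hb₁, hφ₁⟩ := h.exists_mutuallyIndiscernible
  have hx : x = Fin.append (fun q => x (Fin.castAdd n q)) fun q => x (Fin.natAdd m q) :=
    Fin.append_castAdd_natAdd.symm
  rw [hx] at hφ₁
  obtain ⟨N₂, _, _, e₂, a, c, b₂, hb₂, hab, hφ₂⟩ := hb₁.exists_halvesIndiscernibleOver hφ₁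
  exact ⟨N₂, inferInstance, inferInstance, e₁.trans e₂, {i | Cuts L a b₂ i},
    exists_isIrdPattern_of_cuts hb₂ hab _ fun i hi => hi,
    exists_isIrdPattern_of_not_cuts hab hφ₂ _ fun i hi => hi⟩

end

/-! ### Widths of patterns and cardinal arithmetic -/

section Width

variable {L : FirstOrder.Language.{u, v}} {T : L.Theory} {m n : ℕ} {κ κ' : Cardinal.{max u v}}

theorem HasIrdPattern.of_le (h : HasIrdPattern T m κ) (hκ : κ' ≤ κ) : HasIrdPattern T m κ' := by
  obtain ⟨ι, M, k, φ, b, rfl, hb⟩ := h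
  obtain ⟨I, rfl⟩ := Cardinal.le_mk_iff_exists_set.1 hκ
  refine ⟨I, M, fun i => k i, fun i => φ i, fun i => b i, rfl, ?_⟩
  classical
  rw [isIrdPattern_iff] at hb ⊢
  intro η G
  obtain ⟨a, ha⟩ := hb (fun i => if hi : i ∈ I then η ⟨i, hi⟩ else 0)
    (G.image fun p => ((p.1 : ι), p.2))
  refine ⟨a, fun p hp => ?_⟩
  simpa using ha _ (Finset.mem_image_of_mem _ hp)

theorem HasIrdPattern.mono_vars (h : HasIrdPattern T m κ) (hmn : m ≤ n) :
    HasIrdPattern T n κ := by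
  obtain ⟨ι, M, k, φ, b, rfl, hb⟩ := h
  refine ⟨ι, M, k, fun i => (φ i).relabel (Sum.map (Fin.castLE hmn) id), b, rfl, ?_⟩
  rw [isIrdPattern_iff] at hb ⊢
  intro η G
  obtain ⟨a, ha⟩ := hb η G
  let a' : Fin n → M := fun i => if hi : (i : ℕ) < m then a ⟨i, hi⟩ else Classical.arbitrary M
  have ha' : a' ∘ Fin.castLE hmn = a := by
    funext i
    simp [a']
  refine ⟨a', fun p hp => ?_⟩
  rw [Language.Formula.realize_relabel, Sum.elim_comp_map, ha', Function.comp_id]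
  exact ha p hp

theorem HasIrdPattern.exists_add (h : HasIrdPattern T (m + n) κ) :
    ∃ κ₁ κ₂, κ₁ + κ₂ = κ ∧ HasIrdPattern T m κ₁ ∧ HasIrdPattern T n κ₂ := by
  obtain ⟨ι, M, k, φ, b, rfl, hb⟩ := h
  obtain ⟨N, _, _, e, I, ⟨k₁, φ₁, b₁, h₁⟩, k₂, φ₂, b₂, h₂⟩ := hb.exists_split
  have : N ⊨ T := (e.theory_model_iff (T := T)).1 inferInstance
  exact ⟨#I, #(Iᶜ : Set ι), Cardinal.mk_sum_compl I,
    ⟨I, Language.Theory.ModelType.of T N, k₁, φ₁, b₁, rfl, h₁⟩,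
    ⟨(Iᶜ : Set ι), Language.Theory.ModelType.of T N, k₂, φ₂, b₂, rfl, h₂⟩⟩

theorem hasIrdPattern_zero (hT : T.IsSatisfiable) : HasIrdPattern T m 0 := by
  obtain ⟨M⟩ := hT
  refine ⟨PEmpty, M, fun i => i.elim, fun i => i.elim, fun i => i.elim, Cardinal.mk_pempty, ?_⟩
  rw [isIrdPattern_iff]
  exact fun η G => ⟨fun _ => Classical.arbitrary M, fun p => p.1.elim⟩

theorem not_hasIrdPattern_no_vars : ¬ HasIrdPattern T 0 1 := by
  rintro ⟨ι, M, k, φ, b, h1, hb⟩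
  obtain ⟨i⟩ : Nonempty ι := Cardinal.mk_ne_zero_iff.1 (by rw [h1]; exact one_ne_zero)
  rw [isIrdPattern_iff] at hb
  obtain ⟨a, ha⟩ := hb (fun _ => 0) {(i, 0)}
  obtain ⟨a', ha'⟩ := hb (fun _ => 1) {(i, 0)}
  have h0 := ha (i, 0) (Finset.mem_singleton_self _)
  have h1 := ha' (i, 0) (Finset.mem_singleton_self _)
  rw [Subsingleton.elim a' a] at h1
  simp [h0] at h1

/-- The widths of patterns form an initial segment, by `HasIrdPattern.of_le`. -/
theorem coe_lt_kappaIrdVar : (κ : WithTop Cardinal.{max u v}) < kappaIrdVar T m ↔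
    HasIrdPattern T m κ := by
  unfold kappaIrdVar
  split_ifs with h
  · rw [WithTop.coe_lt_coe]
    constructor
    · intro hlt
      by_contra hκ
      exact (not_le.2 hlt) (csInf_le' hκ)
    · intro hκ
      by_contra hlt
      exact csInf_mem (s := {κ : Cardinal.{max u v} | ¬ HasIrdPattern T m κ}) h
        (hκ.of_le (not_lt.1 hlt))
  · simp only [WithTop.coe_lt_top, true_iff]
    by_contra hκ
    exact h ⟨κ, hκ⟩

theorem kappaIrdVar_mono : Monotone (kappaIrdVar T) := by
  intro m n hmn
  refine le_of_forall_lt fun κ hκ => ?_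
  induction κ with
  | top => exact absurd hκ not_top_lt
  | coe κ => exact coe_lt_kappaIrdVar.2 ((coe_lt_kappaIrdVar.1 hκ).mono_vars hmn)

/-- The bound for `m + n` variables is the predecessor of a finite sum, or the sum itself when
infinite. -/
theorem exists_add_one_eq_add {κ κ' : Cardinal.{w}} (hκ : κ ≠ 0) :
    ∃ μ : Cardinal.{w}, μ + 1 = κ + κ' ∧ (ℵ₀ ≤ κ + κ' → μ = κ + κ') := by
  rcases le_or_gt ℵ₀ (κ + κ') with h | h
  · exact ⟨κ + κ', Cardinal.add_one_eq h, fun _ => rfl⟩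
  · obtain ⟨l, hl⟩ := Cardinal.lt_aleph0.1 h
    have hl0 : l ≠ 0 := by
      rintro rfl
      rw [Nat.cast_zero, add_eq_zero] at hl
      exact hκ hl.1
    obtain ⟨l', rfl⟩ := Nat.exists_eq_succ_of_ne_zero hl0
    exact ⟨l', by rw [hl]; push_cast; rfl, fun h' => absurd h (not_lt.2 h')⟩

/-- In the finite case two strict inequalities lose at least `2`, contradicting a loss of exactly
`1`. -/
theorem add_one_ne_add_of_lt {κ κ' κ₁ κ₂ : Cardinal.{w}} (h₁ : κ₁ < κ) (h₂ : κ₂ < κ')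
    (h : κ₁ + κ₂ + 1 = κ + κ') : ℵ₀ ≤ κ + κ' ∧ κ₁ + κ₂ < κ + κ' := by
  rcases le_or_gt ℵ₀ (κ + κ') with hinf | hfin
  · exact ⟨hinf, Cardinal.add_lt_of_lt hinf (h₁.trans_le (self_le_add_right _ _))
      (h₂.trans_le (self_le_add_left _ _))⟩
  · obtain ⟨hκ, hκ'⟩ := Cardinal.add_lt_aleph0_iff.1 hfin
    obtain ⟨a, rfl⟩ := Cardinal.lt_aleph0.1 hκ
    obtain ⟨b, rfl⟩ := Cardinal.lt_aleph0.1 hκ'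
    obtain ⟨c, rfl⟩ := Cardinal.lt_aleph0.1 (h₁.trans hκ)
    obtain ⟨d, rfl⟩ := Cardinal.lt_aleph0.1 (h₂.trans hκ')
    norm_cast at h h₁ h₂
    omega

theorem kappaIrdVar_add_add_one_le (hT : T.IsSatisfiable) (m n : ℕ) :
    kappaIrdVar T (m + n) + 1 ≤ kappaIrdVar T m + kappaIrdVar T n := by
  cases hκ : kappaIrdVar T m with
  | top => simp
  | coe κ =>
    cases hκ' : kappaIrdVar T n with
    | top => simp
    | coe κ' =>
      have hκ0 : κ ≠ 0 := by
        rintro rfl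
        have := coe_lt_kappaIrdVar.2 (hasIrdPattern_zero (m := m) hT)
        rw [hκ] at this
        exact lt_irrefl _ this
      obtain ⟨μ, hμ, hμ'⟩ := exists_add_one_eq_add (κ' := κ') hκ0
      have key : kappaIrdVar T (m + n) ≤ μ := by
        by_contra hlt
        obtain ⟨κ₁, κ₂, rfl, h₁, h₂⟩ := (coe_lt_kappaIrdVar.1 (not_le.1 hlt)).exists_add
        rw [← coe_lt_kappaIrdVar, hκ, WithTop.coe_lt_coe] at h₁
        rw [← coe_lt_kappaIrdVar, hκ', WithTop.coe_lt_coe] at h₂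
        obtain ⟨h3, h4⟩ := add_one_ne_add_of_lt h₁ h₂ hμ
        exact h4.ne (hμ' h3)
      calc kappaIrdVar T (m + n) + 1 ≤ (μ : WithTop Cardinal.{max u v}) + 1 := by gcongr
        _ = ((μ + 1 : Cardinal.{max u v}) : WithTop Cardinal.{max u v}) := by
          rw [WithTop.coe_add, WithTop.coe_one]
        _ = (κ : WithTop Cardinal.{max u v}) + κ' := by rw [hμ, WithTop.coe_add]

theorem kappaIrdVar_succ_le (hT : T.IsSatisfiable) (m : ℕ) :
    kappaIrdVar T (m + 1) ≤ kappaIrdVar T m + kappaIrdVar T 1 :=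
  le_self_add.trans (kappaIrdVar_add_add_one_le hT m 1)

theorem kappaIrdVar_no_vars_le : kappaIrdVar T 0 ≤ ((1 : Cardinal.{max u v}) : WithTop _) :=
  not_lt.1 fun h => not_hasIrdPattern_no_vars (coe_lt_kappaIrdVar.1 h)

theorem kappaIrdVar_lt_aleph0 (hT : T.IsSatisfiable)
    (h : kappaIrdVar T 1 < ((ℵ₀ : Cardinal.{max u v}) : WithTop Cardinal.{max u v})) (m : ℕ) :
    kappaIrdVar T m < ((ℵ₀ : Cardinal.{max u v}) : WithTop Cardinal.{max u v}) := by
  induction m with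
  | zero => exact kappaIrdVar_no_vars_le.trans_lt (WithTop.coe_lt_coe.2 Cardinal.one_lt_aleph0)
  | succ m ih =>
    refine (kappaIrdVar_succ_le hT m).trans_lt ?_
    obtain ⟨κ, hκ, hκ'⟩ := WithTop.lt_iff_exists_coe.1 h
    obtain ⟨μ, hμ, hμ'⟩ := WithTop.lt_iff_exists_coe.1 ih
    rw [hκ, hμ, ← WithTop.coe_add, WithTop.coe_lt_coe]
    exact Cardinal.add_lt_aleph0 (WithTop.coe_lt_coe.1 hμ') (WithTop.coe_lt_coe.1 hκ')

/-- Each further variable adds at most the one-variable value, which an infinite value absorbs. -/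
theorem kappaIrdVar_le_of_aleph0_le (hT : T.IsSatisfiable)
    (h : ((ℵ₀ : Cardinal.{max u v}) : WithTop Cardinal.{max u v}) ≤ kappaIrdVar T 1) (m : ℕ) :
    kappaIrdVar T m ≤ kappaIrdVar T 1 := by
  induction m with
  | zero => exact kappaIrdVar_mono zero_le_one
  | succ m ih =>
    refine (kappaIrdVar_succ_le hT m).trans ((add_le_add_left ih _).trans ?_)
    cases hκ : kappaIrdVar T 1 with
    | top => exact le_top
    | coe κ =>
      rw [hκ, WithTop.coe_le_coe] at h
      rw [← WithTop.coe_add, WithTop.coe_le_coe, Cardinal.add_eq_self h]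

end Width

end IrdPattern

theorem corollary3p4 {L : FirstOrder.Language.{u, v}} (T : L.Theory) (hT : T.IsComplete) :
    (∀ m n : ℕ, IrdPattern.kappaIrdVar T (m + n) + 1 ≤
      IrdPattern.kappaIrdVar T m + IrdPattern.kappaIrdVar T n) ∧
    (∀ m : ℕ, ((ℵ₀ : Cardinal.{max u v}) : WithTop Cardinal.{max u v}) ≤
        IrdPattern.kappaIrdVar T m →
      IrdPattern.kappaIrdVar T m = IrdPattern.kappaIrdVar T 1 ∧
      IrdPattern.kappaIrdVar T 1 = IrdPattern.kappaIrd T) := by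
  refine ⟨IrdPattern.kappaIrdVar_add_add_one_le hT.1, fun m hm => ?_⟩
  have h1 : ((ℵ₀ : Cardinal.{max u v}) : WithTop Cardinal.{max u v}) ≤ IrdPattern.kappaIrdVar T 1 :=
    not_lt.1 fun h => not_lt.2 hm (IrdPattern.kappaIrdVar_lt_aleph0 hT.1 h m)
  have hle := IrdPattern.kappaIrdVar_le_of_aleph0_le hT.1 h1
  have hm0 : 1 ≤ m := by
    refine Nat.one_le_iff_ne_zero.2 ?_
    rintro rfl
    have := hm.trans IrdPattern.kappaIrdVar_no_vars_le
    exact absurd (WithTop.coe_le_coe.1 this) (not_le.2 Cardinal.one_lt_aleph0)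
  exact ⟨le_antisymm (hle m) (IrdPattern.kappaIrdVar_mono hm0),
    le_antisymm (le_ciSup (OrderTop.bddAbove _) 1) (ciSup_le hle)⟩
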